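/- Let $(R,\mathfrak m)$ be a two-dimensional regular local ring with infinite residue field, let $x,y$ be generators of $\mathfrak m=(x,y)$, and let $m,n\ge 2$ be integers. Let $M$ be a finitely generated torsion-free $R$-module of rank two, and regard $M$ as a submodule of its double dual $F=M^{**}$, which is a free $R$-module of rank two. Let $I(M)$ denote the ideal generated by the $2\times 2$ minors of a matrix whose columns are the coordinates, in a basis of $F$, of a set of generators of $M$. Call an element $v\in F$ integral over $M$ if $v$, regarded as an element of degree one of the symmetric algebra $\operatorname{Sym}_R(F)\cong R[X_1,X_2]$, is integral over the $R$-subalgebra generated by the elements of $M$, and call $M$ integrally closed if every element of $F$ that is integral over $M$ lies in $M$. Suppose that $M$ is integrally closed, that $M$ has no nonzero free direct summand, and that $I(M)=(x^m,\,xy,\,y^n)$. Then $$M\;\cong\;(x,\,y^{n-1})\oplus(x^{m-1},\,y)$$ as $R$-modules. In particular, $M$ is decomposable, i.e. it is the direct sum of two nonzero submodules. -/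

import Mathlib

namespace RankTwo

open Module

universe u v

/-- The double dual `F = M**` of `M`. It is free when `M` is a finitely generated torsion-free
module over a two-dimensional regular local ring. -/
abbrev Bidual (R : Type u) (M : Type v) [CommRing R] [AddCommGroup M] [Module R M] :
    Type (max u v) :=
  Dual R (Dual R M)

/-- The canonical map `M → M**` (injective if `M` is finitely generated and torsion-free over a
domain). Its range is the copy of `M` inside `F = M**`. -/
abbrev toBidual (R : Type u) (M : Type v) [CommRing R] [AddCommGroup M] [Module R M] :
    M →ₗ[R] Bidual R M :=
  Dual.eval R M

/-- `I(M)`, the ideal of maximal minors: write the elements of `M ⊆ F = M**` as column vectors in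
a basis of `F`, and take the ideal generated by the determinants of the square matrices whose
columns lie in `M`. See `minorIdeal_eq`: any one basis and any one generating matrix suffice. -/
def minorIdeal (R : Type u) (M : Type v) [CommRing R] [AddCommGroup M] [Module R M] : Ideal R :=
  Ideal.span {d : R | ∃ (b : Basis (Fin (finrank R M)) R (Bidual R M))
    (c : Fin (finrank R M) → M), d = (b.toMatrix fun j => toBidual R M (c j)).det}

/-- `I(M)` is the ideal of maximal minors of any matrix whose columns, in any basis of `M**`,
are the coordinates of a family of generators of `M`. -/
theorem minorIdeal_eq {R : Type u} {M : Type v} [CommRing R] [AddCommGroup M] [Module R M]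
    (b : Basis (Fin (finrank R M)) R (Bidual R M)) {ι : Type*} (a : ι → M)
    (ha : Submodule.span R (Set.range a) = ⊤) :
    minorIdeal R M = Ideal.span (Set.range fun s : Fin (finrank R M) → ι =>
      (b.toMatrix fun j => toBidual R M (a (s j))).det) := by
  classical
  apply le_antisymm
  · refine Ideal.span_le.2 ?_
    rintro _ ⟨b', c, rfl⟩
    have hb : ∀ w : Fin (finrank R M) → Bidual R M,
        (b'.toMatrix w).det = (b'.toMatrix b).det * (b.toMatrix w).det := by
      intro w
      rw [← Matrix.det_mul, Basis.toMatrix_mul_toMatrix]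
    rw [SetLike.mem_coe, hb]
    refine Ideal.mul_mem_left _ _ ?_
    have key : ∀ (t : Finset (Fin (finrank R M))) (c : Fin (finrank R M) → M),
        (∀ j, j ∉ t → c j ∈ Set.range a) →
        (b.toMatrix fun j => toBidual R M (c j)).det ∈
          Ideal.span (Set.range fun s : Fin (finrank R M) → ι =>
            (b.toMatrix fun j => toBidual R M (a (s j))).det) := by
      intro t
      induction t using Finset.induction_on with
      | empty =>
        intro c hc
        choose s hs using fun j => hc j (Finset.notMem_empty j)
        refine Ideal.subset_span ⟨s, ?_⟩
        simp only [hs]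
      | insert i t hi ih =>
        intro c hc
        let f : M →ₗ[R] R := (b.det.compLinearMap (toBidual R M)).toMultilinearMap.toLinearMap c i
        have hf : ∀ m, f m =
            (b.toMatrix fun j => toBidual R M (Function.update c i m j)).det := fun m => rfl
        have hle : Submodule.span R (Set.range a) ≤ Submodule.comap f
            (Ideal.span (Set.range fun s : Fin (finrank R M) → ι =>
              (b.toMatrix fun j => toBidual R M (a (s j))).det)) := by
          rw [Submodule.span_le]
          rintro _ ⟨k, rfl⟩
          rw [SetLike.mem_coe, Submodule.mem_comap, hf]
          refine ih _ fun j hj => ?_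
          by_cases hji : j = i
          · subst hji
            simp
          · rw [Function.update_of_ne hji]
            exact hc j (by simp [hji, hj])
        have := hle (ha ▸ Submodule.mem_top : c i ∈ _)
        rw [Submodule.mem_comap, hf, Function.update_eq_self] at this
        exact this
    exact key Finset.univ c fun j hj => absurd (Finset.mem_univ j) hj
  · refine Ideal.span_le.2 ?_
    rintro _ ⟨s, rfl⟩
    exact Ideal.subset_span ⟨b, fun j => a (s j), rfl⟩

/-- An element `v` of `F = M**` is integral over `M` if, regarded as a linear form (a degree-one
element of the symmetric algebra of `F`, which is a polynomial ring over `R`), it is integral over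
the `R`-subalgebra generated by the elements of `M`. -/
def IsIntegralOver (R : Type u) (M : Type v) [CommRing R] [AddCommGroup M] [Module R M]
    (v : Bidual R M) : Prop :=
  IsIntegral
    (Algebra.adjoin R
      (Set.range fun m : M => SymmetricAlgebra.ι R (Bidual R M) (toBidual R M m)))
    (SymmetricAlgebra.ι R (Bidual R M) v)

/-- `M` is integrally closed: every element of `M**` that is integral over `M` lies in `M`. -/
def IsIntegrallyClosedModule (R : Type u) (M : Type v) [CommRing R] [AddCommGroup M]
    [Module R M] : Prop :=
  ∀ v : Bidual R M, IsIntegralOver R M v → v ∈ LinearMap.range (toBidual R M)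

/-- `M` has no nonzero free direct summand. -/
def HasNoFreeSummand (R : Type u) (M : Type v) [CommRing R] [AddCommGroup M] [Module R M] :
    Prop :=
  ∀ P Q : Submodule R M, IsCompl P Q → Module.Free R P → P = ⊥

/-- `M` is the direct sum of two nonzero submodules. -/
def IsDecomposable (R : Type u) (M : Type v) [CommRing R] [AddCommGroup M] [Module R M] : Prop :=
  ∃ P Q : Submodule R M, P ≠ ⊥ ∧ Q ≠ ⊥ ∧ IsCompl P Q

end RankTwo

/-!
Write `v ∧ w` for the determinant of two vectors of `F = M**` in a fixed basis, and
`I = I(M) = (x ^ m, x y, y ^ n)`.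

The integral closedness of `M` enters only through a determinantal criterion
(`isIntegralOver_of_wedge_mem`): if `v ∧ a ∈ I` for all `a ∈ M`, then Cramer's rule
`(a ∧ c) v = (v ∧ c) a + (a ∧ v) c` gives `I v ⊆ I M`, and the determinant trick shows that `v` is
integral over `M`. Hence `M = {v | v ∧ M ⊆ I}`. The absence of free summands means `M ⊆ 𝔪 F`. These
facts, with `I` generated by the determinants of pairs in `M`, are recorded in `IsSelfPolar`, and
the rest is a computation with them.

It suffices to find a basis `e₁, e₂` of `F` such that `x (e₁ ∧ v) ∈ I` and `y (v ∧ e₂) ∈ I` for all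
`v ∈ M` (`IsAdapted`). Indeed `I : y = (x, y ^ (n - 1))` and `I : x = (x ^ (m - 1), y)`, so `M` is
contained in `(x, y ^ (n - 1)) e₁ + (x ^ (m - 1), y) e₂`; the determinants of pairs in the latter
module lie in `I`, so it is contained in `M` (`IsSelfPolar.mem_iff`).

* If `m = 2`, then `x F ⊆ M`, and `M` contains some `y e₂` with `e₂` a basis vector, as otherwise
  `M ⊆ x F + y ^ 2 F` and `x y ∉ I`. The case `n = 2` is symmetric.
* If `m, n ≥ 3`, then `I ⊆ (x y) + 𝔪 ^ 3`. Comparing coefficients of quadratic forms in the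
  determinants of pairs in `M` shows that the image of `M` in `𝔪 F / 𝔪 ^ 2 F` is spanned by the
  classes of `x e₁` and `y e₂` for some basis. Using `x y F ⊆ M`, the basis can be improved until
  `(x + y ^ 2 s) e₁` and `(y + x ^ 2 t) e₂` lie in `M`, and their determinant shows that
  `y ^ 3 s, x ^ 3 t ∈ I`.

About the ring one needs only that `R` is a domain in which `x` and `y` are primes not dividing each
other.
-/

namespace RankTwo

open Module IsLocalRing

/-! ### Two-dimensional regular local rings -/

section Ring
variable {R : Type*} [CommRing R]

/-- No power of `t` lies in `(z)`: otherwise the maximal ideal would be minimal over `(z)`, of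
height at most one. -/
theorem notMem_span_pow_of_ringKrullDim [IsLocalRing R] [IsNoetherianRing R]
    (hdim : ringKrullDim R = 2) {z t : R} (hzt : maximalIdeal R = Ideal.span {z, t}) (k : ℕ) :
    t ^ k ∉ Ideal.span {z} := by
  intro h
  have hz : z ∈ maximalIdeal R := hzt ▸ Ideal.subset_span (by simp)
  have hmin : maximalIdeal R ∈ (Ideal.span {z}).minimalPrimes := by
    refine ⟨⟨inferInstance, (Ideal.span_singleton_le_iff_mem _).2 hz⟩, ?_⟩
    rintro q ⟨hq, hzq⟩ -
    rw [hzt, Ideal.span_le]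
    rintro _ (rfl | rfl)
    · exact hzq (Ideal.mem_span_singleton_self _)
    · exact hq.mem_of_pow_mem k (hzq h)
  have h1 := Ideal.height_le_one_of_isPrincipal_of_mem_minimalPrimes _ _ hmin
  have h2 := maximalIdeal_height_eq_ringKrullDim (R := R)
  rw [hdim] at h2
  have h3 : (maximalIdeal R).height = 2 := WithBot.coe_inj.1 h2
  rw [h3] at h1
  exact absurd h1 (by decide)

/-- Modulo `z` the maximal ideal is generated by the image of `t`, so by Krull's intersection
theorem every nonzero element of `R ⧸ (z)` is a unit times a power of `t`. -/
theorem span_singleton_isPrime_of_ringKrullDim [IsLocalRing R] [IsNoetherianRing R]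
    (hdim : ringKrullDim R = 2) {z t : R} (hzt : maximalIdeal R = Ideal.span {z, t}) :
    (Ideal.span {z}).IsPrime := by
  have hz : z ∈ maximalIdeal R := hzt ▸ Ideal.subset_span (by simp)
  have hle : Ideal.span {z} ≤ maximalIdeal R := (Ideal.span_singleton_le_iff_mem _).2 hz
  have hne : Ideal.span {z} ≠ ⊤ := fun h =>
    (maximalIdeal.isMaximal R).ne_top (top_le_iff.1 (h ▸ hle))
  have hfac : ∀ a : R, a ∉ Ideal.span {z} →
      ∃ (n : ℕ) (c : R), IsUnit c ∧ a - t ^ n * c ∈ Ideal.span {z} := by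
    intro a ha
    by_contra! hcon
    -- otherwise `a` lies in all the ideals `(z) + 𝔪 ^ n`, whose intersection is `(z)`
    have hdiv : ∀ n : ℕ, ∃ c, a - t ^ n * c ∈ Ideal.span {z} := by
      intro n
      induction n with
      | zero => exact ⟨a, by simp⟩
      | succ n ih =>
        obtain ⟨c, hc⟩ := ih
        have hcm : c ∈ maximalIdeal R := by
          by_contra h
          exact hcon n c (by simpa using h) hc
        rw [hzt, Ideal.mem_span_pair] at hcm
        obtain ⟨p, q, rfl⟩ := hcm
        refine ⟨q, ?_⟩
        have : a - t ^ (n + 1) * q = (a - t ^ n * (p * z + q * t)) + t ^ n * p * z := by ring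
        rw [this]
        exact Ideal.add_mem _ hc (Ideal.mul_mem_left _ _ (Ideal.mem_span_singleton_self z))
    have : Nontrivial (R ⧸ Ideal.span {z}) := Ideal.Quotient.nontrivial_iff.2 hne
    have : IsLocalRing (R ⧸ Ideal.span {z}) :=
      .of_surjective' (Ideal.Quotient.mk _) Ideal.Quotient.mk_surjective
    have hJ : Ideal.span {Ideal.Quotient.mk (Ideal.span {z}) t} ≠ ⊤ := by
      rw [Ne, Ideal.span_singleton_eq_top]
      intro hu
      have := IsLocalHom.of_surjective (Ideal.Quotient.mk (Ideal.span {z}))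
        Ideal.Quotient.mk_surjective
      have ht : t ∈ maximalIdeal R := hzt ▸ Ideal.subset_span (by simp)
      exact ht (isUnit_of_map_unit _ _ hu)
    have hinf := Ideal.iInf_pow_eq_bot_of_isLocalRing _ hJ
    refine ha (Ideal.Quotient.eq_zero_iff_mem.1 ?_)
    rw [← Ideal.mem_bot, ← hinf, Ideal.mem_iInf]
    intro n
    obtain ⟨c, hc⟩ := hdiv n
    rw [Ideal.span_singleton_pow, Ideal.mem_span_singleton]
    refine ⟨Ideal.Quotient.mk _ c, ?_⟩
    rw [← map_pow, ← map_mul]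
    exact (Ideal.Quotient.mk_eq_mk_iff_sub_mem _ _).2 hc
  refine ⟨hne, fun {a b} hab => ?_⟩
  by_contra! h
  obtain ⟨n, c, hc, hac⟩ := hfac a h.1
  obtain ⟨k, d, hd, hbd⟩ := hfac b h.2
  have hmem : t ^ (n + k) * (c * d) ∈ Ideal.span {z} := by
    have : t ^ (n + k) * (c * d) = a * b - (a - t ^ n * c) * b - t ^ n * c * (b - t ^ k * d) := by
      ring
    rw [this]
    exact Ideal.sub_mem _ (Ideal.sub_mem _ hab (Ideal.mul_mem_right _ _ hac))
      (Ideal.mul_mem_left _ _ hbd)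
  exact notMem_span_pow_of_ringKrullDim hdim hzt (n + k)
    ((Ideal.mul_unit_mem_iff_mem _ (hc.mul hd)).1 hmem)

/-- The prime ideals `(x + y ^ (k + 1))` are pairwise distinct, so one of them is not a minimal
prime. A minimal prime `P` strictly below this prime `(z)` satisfies `P = z P`, hence vanishes by
Nakayama's lemma. -/
theorem isDomain_of_ringKrullDim [IsLocalRing R] [IsNoetherianRing R]
    (hdim : ringKrullDim R = 2) {x y : R} (hxy : maximalIdeal R = Ideal.span {x, y}) :
    IsDomain R := by
  have hz : ∀ k : ℕ, maximalIdeal R = Ideal.span {x + y ^ (k + 1), y} := by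
    intro k
    rw [hxy, pow_succ, Set.pair_comm, Set.pair_comm _ y]
    exact (Ideal.span_pair_add_mul_left (x := y) (y := x) (y ^ k)).symm
  have hy : y ∈ maximalIdeal R := hxy ▸ Ideal.subset_span (by simp)
  have hinj : Function.Injective fun k : ℕ => Ideal.span {x + y ^ (k + 1)} := by
    apply Function.Injective.of_lt_imp_ne
    intro k j hkj heq
    have h1 : x + y ^ (k + 1) ∈ Ideal.span {x + y ^ (k + 1)} := Ideal.mem_span_singleton_self _
    have h2 : x + y ^ (j + 1) ∈ Ideal.span {x + y ^ (k + 1)} := by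
      rw [heq]; exact Ideal.mem_span_singleton_self _
    have hu : IsUnit (1 - y ^ (j - k)) := by
      have : y ^ (j - k) ∈ maximalIdeal R := Ideal.pow_mem_of_mem _ hy _ (by omega)
      by_contra h
      exact (maximalIdeal.isMaximal R).ne_top
        ((Ideal.eq_top_iff_one _).2 (by simpa using Ideal.add_mem _ h this))
    have h3 : y ^ (k + 1) * (1 - y ^ (j - k)) ∈ Ideal.span {x + y ^ (k + 1)} := by
      have : y ^ (k + 1) * (1 - y ^ (j - k)) = x + y ^ (k + 1) - (x + y ^ (j + 1)) := by
        obtain ⟨d, rfl⟩ := Nat.exists_eq_add_of_lt hkj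
        rw [show k + d + 1 - k = d + 1 by omega]
        ring
      rw [this]
      exact Ideal.sub_mem _ h1 h2
    exact notMem_span_pow_of_ringKrullDim hdim (hz k) _ ((Ideal.mul_unit_mem_iff_mem _ hu).1 h3)
  obtain ⟨k, hk⟩ : ∃ k : ℕ, Ideal.span {x + y ^ (k + 1)} ∉ minimalPrimes R := by
    by_contra! hcon
    exact Set.infinite_range_of_injective hinj
      ((minimalPrimes.finite_of_isNoetherianRing R).subset (Set.range_subset_iff.2 hcon))
  have hprime := span_singleton_isPrime_of_ringKrullDim hdim (hz k)
  obtain ⟨P, hP, hPz⟩ := Ideal.exists_minimalPrimes_le (I := ⊥) (J := Ideal.span {x + y ^ (k + 1)})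
    bot_le
  have hPp : P.IsPrime := hP.1.1
  have hzP : x + y ^ (k + 1) ∉ P := fun h =>
    hk (le_antisymm hPz ((Ideal.span_singleton_le_iff_mem _).2 h) ▸ hP)
  have hbot : P = ⊥ := by
    refine Submodule.eq_bot_of_le_smul_of_le_jacobson_bot (maximalIdeal R) P
      (IsNoetherian.noetherian P) ?_ (maximalIdeal_le_jacobson ⊥)
    intro p hp
    obtain ⟨c, rfl⟩ := Ideal.mem_span_singleton'.1 (hPz hp)
    have hc : c ∈ P := (hPp.mem_or_mem hp).resolve_right hzP
    rw [mul_comm]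
    exact Submodule.smul_mem_smul (hz k ▸ Ideal.subset_span (by simp)) hc
  rw [hbot] at hPp
  exact IsDomain.of_bot_isPrime R

end Ring

/-! ### The determinant pairing on a free module of rank two -/

section Wedge
variable {R F : Type*} [CommRing R] [AddCommGroup F] [Module R F]

/-- The determinant of two vectors of a free module of rank two, in the coordinates of the
basis `b`. -/
noncomputable def wedge (b : Basis (Fin 2) R F) : F →ₗ[R] F →ₗ[R] R :=
  LinearMap.mk₂ R (fun v w => b.repr v 0 * b.repr w 1 - b.repr v 1 * b.repr w 0)
    (fun _ _ _ => by simp; ring) (fun _ _ _ => by simp; ring)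
    (fun _ _ _ => by simp; ring) (fun _ _ _ => by simp; ring)

variable (b : Basis (Fin 2) R F)

theorem wedge_apply (v w : F) :
    wedge b v w = b.repr v 0 * b.repr w 1 - b.repr v 1 * b.repr w 0 := rfl

theorem wedge_self (v : F) : wedge b v v = 0 := by rw [wedge_apply]; ring

theorem wedge_swap (v w : F) : wedge b v w = -wedge b w v := by simp only [wedge_apply]; ring

theorem det_toMatrix_eq_wedge (c : Fin 2 → F) : (b.toMatrix c).det = wedge b (c 0) (c 1) := by
  rw [Matrix.det_fin_two, wedge_apply]
  simp only [Basis.toMatrix_apply]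
  ring

/-- Cramer's rule: the coordinates of `z` with respect to `v, w` are determinants. -/
theorem wedge_smul_eq (v w z : F) :
    wedge b v w • z = wedge b z w • v + wedge b v z • w := by
  apply b.repr.injective
  ext i
  fin_cases i <;> simp [wedge_apply] <;> ring

/-- The Plücker relation. -/
theorem wedge_mul_wedge (v w z t : F) :
    wedge b v w * wedge b z t = wedge b z w * wedge b v t + wedge b v z * wedge b w t := by
  simp only [wedge_apply]; ring

theorem eq_smul_add_smul_of_mul_eq_one {b : Basis (Fin 2) R F} {a d : F} {r : R}
    (hr : wedge b a d * r = 1) (c : F) :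
    c = (wedge b c d * r) • a + (wedge b a c * r) • d := by
  have h := congrArg (r • ·) (wedge_smul_eq b a d c)
  simp only [smul_add, smul_smul] at h
  rw [mul_comm r, hr, one_smul, mul_comm r, mul_comm r] at h
  exact h

end Wedge

/-! ### The double dual and the determinantal criterion for integral dependence -/

section Bidual
variable {R M : Type*} [CommRing R] [AddCommGroup M] [Module R M]

/-- A nonzero element of a finitely generated torsion-free module survives over the fraction field,
where a linear form detects it. -/
theorem toBidual_injective [IsDomain R] [IsNoetherianRing R] [Module.Finite R M]
    [IsTorsionFree R M] : Function.Injective (toBidual R M) := by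
  rw [← LinearMap.ker_eq_bot, LinearMap.ker_eq_bot']
  intro a ha
  by_contra hne
  let K := FractionRing R
  let f := LocalizedModule.mkLinearMap (nonZeroDivisors R) M
  let g := Algebra.linearMap R K
  have hfa : f a ≠ 0 := by
    intro h
    obtain ⟨s, hs⟩ := (IsLocalizedModule.eq_zero_iff (nonZeroDivisors R) f).1 h
    exact (smul_eq_zero.1 hs).elim (nonZeroDivisors.ne_zero s.2) hne
  obtain ⟨φ, hφ⟩ : ∃ φ : Dual K (LocalizedModule (nonZeroDivisors R) M), φ (f a) ≠ 0 := by
    by_contra! h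
    exact hfa ((Module.forall_dual_apply_eq_zero_iff K _).1 h)
  -- clearing denominators, `φ` comes from a linear form on `M`
  have hM : Module.FinitePresentation R M := Module.finitePresentation_of_finite R M
  obtain ⟨⟨ψ, s⟩, hψ⟩ := IsLocalizedModule.surj (nonZeroDivisors R)
    (IsLocalizedModule.map (nonZeroDivisors R) f g) (φ.restrictScalars R)
  have h1 : (s : R) • φ (f a) = g (ψ a) := by
    rw [← IsLocalizedModule.map_apply (nonZeroDivisors R) f g ψ a]
    exact LinearMap.congr_fun hψ (f a)
  have h2 : ψ a = 0 := LinearMap.congr_fun ha ψ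
  rw [h2, map_zero] at h1
  exact (smul_eq_zero.1 h1).elim (nonZeroDivisors.ne_zero s.2) hφ

/-- The determinantal criterion for integral dependence. If all determinants `v ∧ a` with `a ∈ M`
lie in `J = I(M)`, then Cramer's rule gives `J v ⊆ J M`, so that multiplication by `v` preserves the
finitely generated faithful module `J A` over the algebra `A` generated by `M`. -/
theorem isIntegralOver_of_wedge_mem [IsDomain R] (b : Basis (Fin 2) R (Bidual R M)) (J : Ideal R)
    (hJ : J = Ideal.span {d | ∃ a c : M, d = wedge b (toBidual R M a) (toBidual R M c)})
    (hfg : J.FG) (hbot : J ≠ ⊥) (v : Bidual R M)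
    (hv : ∀ a : M, wedge b v (toBidual R M a) ∈ J) : IsIntegralOver R M v := by
  have hdom : IsDomain (SymmetricAlgebra R (Bidual R M)) :=
    (SymmetricAlgebra.equivMvPolynomial b).toMulEquiv.isDomain _
  set S := SymmetricAlgebra R (Bidual R M)
  set A := Algebra.adjoin R
      (Set.range fun m : M => SymmetricAlgebra.ι R (Bidual R M) (toBidual R M m)) with hA
  -- the `A`-submodule `J A` of the symmetric algebra is stable under multiplication by `v`
  set N : Submodule A S := Submodule.span A (algebraMap R S '' (J : Set R)) with hN
  have hmem : ∀ r ∈ J, ∀ s ∈ A, s * algebraMap R S r ∈ N := fun r hr s hs =>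
    N.smul_mem (⟨s, hs⟩ : A) (Submodule.subset_span ⟨r, hr, rfl⟩)
  have hMA : ∀ a : M, SymmetricAlgebra.ι R (Bidual R M) (toBidual R M a) ∈ A := fun a =>
    Algebra.subset_adjoin ⟨a, rfl⟩
  refine isIntegral_of_smul_mem_submodule (A := S) (M := S) N ?_ ?_ _ ?_
  · obtain ⟨r, hr, hr0⟩ := Submodule.exists_mem_ne_zero_of_ne_bot hbot
    intro h
    have : algebraMap R S r ∈ N := Submodule.subset_span ⟨r, hr, rfl⟩
    rw [h, Submodule.mem_bot, SymmetricAlgebra.algebraMap_eq_zero_iff] at this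
    exact hr0 this
  · obtain ⟨t, ht⟩ := hfg
    classical
    refine ⟨t.image (algebraMap R S), le_antisymm ?_ ?_⟩
    · refine Submodule.span_mono ?_
      rw [Finset.coe_image]
      exact Set.image_mono (ht ▸ Ideal.subset_span)
    · rw [hN, Submodule.span_le]
      rintro _ ⟨r, hr, rfl⟩
      rw [Finset.coe_image]
      have hle : J ≤ ((Submodule.span A (algebraMap R S '' (t : Set R))).restrictScalars R).comap
          (Algebra.linearMap R S) := by
        rw [← ht, Submodule.span_le]
        exact fun r hr => Submodule.subset_span ⟨r, hr, rfl⟩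
      exact hle hr
  · have hgen : J ≤ (N.restrictScalars R).comap
        ((LinearMap.mulLeft R (SymmetricAlgebra.ι R (Bidual R M) v)).comp
          (Algebra.linearMap R S)) := by
      conv_lhs => rw [hJ]
      rw [Submodule.span_le]
      rintro _ ⟨a, c, rfl⟩
      rw [SetLike.mem_coe, Submodule.mem_comap]
      have h := congrArg (SymmetricAlgebra.ι R (Bidual R M))
        (wedge_smul_eq b (toBidual R M a) (toBidual R M c) v)
      rw [map_smul, map_add, map_smul, map_smul, Algebra.smul_def, Algebra.smul_def,
        Algebra.smul_def] at h
      simp only [LinearMap.comp_apply, LinearMap.mulLeft_apply, Algebra.linearMap_apply]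
      rw [mul_comm, h, mul_comm _ (SymmetricAlgebra.ι R _ _), mul_comm _ (SymmetricAlgebra.ι R _ _)]
      refine N.add_mem (hmem _ (hv c) _ (hMA a)) (hmem _ ?_ _ (hMA c))
      rw [wedge_swap]
      exact J.neg_mem (hv a)
    intro s hs
    rw [hN] at hs
    induction hs using Submodule.span_induction with
    | mem s hs =>
      obtain ⟨r, hr, rfl⟩ := hs
      exact hgen hr
    | zero => simp
    | add s t _ _ hs ht => rw [smul_add]; exact N.add_mem hs ht
    | smul p s _ hs => rw [smul_comm]; exact N.smul_mem p hs

/-- If `M` has no nonzero free direct summand, then `M ⊆ 𝔪 F`: an element of `M` with a unit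
coordinate would span a free direct summand. -/
theorem repr_toBidual_mem_maximalIdeal [IsDomain R] [IsLocalRing R] [IsTorsionFree R M]
    (hfree : HasNoFreeSummand R M) {ι : Type*} (b : Basis ι R (Bidual R M)) (a : M) (i : ι) :
    b.repr (toBidual R M a) i ∈ maximalIdeal R := by
  by_contra h
  obtain ⟨u, hu⟩ : IsUnit (b.repr (toBidual R M a) i) := by simpa using h
  let f : M →ₗ[R] R := (↑u⁻¹ : R) • (b.coord i ∘ₗ toBidual R M)
  have hfa : f a = 1 := by simp [f, ← hu]
  have ha : a ≠ 0 := by rintro rfl; simp at hfa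
  have hcompl : IsCompl (Submodule.span R {a}) (LinearMap.ker f) := by
    rw [isCompl_iff, Submodule.disjoint_def, codisjoint_iff, eq_top_iff]
    constructor
    · intro z hz hzf
      obtain ⟨r, rfl⟩ := Submodule.mem_span_singleton.1 hz
      rw [LinearMap.mem_ker, map_smul, hfa, smul_eq_mul, mul_one] at hzf
      rw [hzf, zero_smul]
    · intro z _
      refine Submodule.mem_sup.2 ⟨f z • a,
        Submodule.smul_mem _ _ (Submodule.mem_span_singleton_self a),
        z - f z • a, ?_, by abel⟩
      simp [hfa]
  have := hfree _ _ hcompl (Module.Free.of_equiv (LinearEquiv.toSpanNonzeroSingleton R M a ha))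
  exact ha (Submodule.span_singleton_eq_bot.1 this)

theorem isDecomposable_of_prod {A B : Type*} [AddCommGroup A] [Module R A] [AddCommGroup B]
    [Module R B] [Nontrivial A] [Nontrivial B] (e : M ≃ₗ[R] A × B) : IsDecomposable R M := by
  have hinj : Function.Injective (Submodule.map (e.symm : (A × B) →ₗ[R] M)) :=
    Submodule.map_injective_of_injective e.symm.injective
  refine ⟨(LinearMap.range (LinearMap.inl R A B)).map (e.symm : (A × B) →ₗ[R] M),
    (LinearMap.range (LinearMap.inr R A B)).map (e.symm : (A × B) →ₗ[R] M), ?_, ?_, ?_⟩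
  · obtain ⟨z, hz⟩ := exists_ne (0 : A)
    rw [Ne, ← Submodule.map_bot (e.symm : (A × B) →ₗ[R] M), hinj.eq_iff, LinearMap.range_eq_bot]
    intro h
    exact hz (by simpa using congrArg Prod.fst (LinearMap.congr_fun h z))
  · obtain ⟨z, hz⟩ := exists_ne (0 : B)
    rw [Ne, ← Submodule.map_bot (e.symm : (A × B) →ₗ[R] M), hinj.eq_iff, LinearMap.range_eq_bot]
    intro h
    exact hz (by simpa using congrArg Prod.snd (LinearMap.congr_fun h z))
  · exact (Submodule.orderIsoMapComap e.symm).isCompl LinearMap.isCompl_range_inl_inr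

end Bidual

/-! ### Membership in ideals generated by monomials in two primes -/

section Ring
variable {R : Type*} [CommRing R] {x y : R}

/-- The colon ideal `(x ^ (m + 1), x y, y ^ (n + 1)) : y` is contained in `(x, y ^ n)`. -/
theorem mem_span_of_mul_mem [IsDomain R] (hy : Prime y) (hyx : ¬ y ∣ x) (m n : ℕ) {r : R}
    (h : y * r ∈ Ideal.span {x ^ (m + 1), x * y, y ^ (n + 1)}) : r ∈ Ideal.span {x, y ^ n} := by
  obtain ⟨p, q, s, h⟩ := Submodule.mem_span_triple.1 h
  simp only [smul_eq_mul] at h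
  have hd : y ∣ p * x ^ (m + 1) := ⟨r - q * x - s * y ^ n, by linear_combination h⟩
  obtain ⟨p', rfl⟩ := (hy.dvd_or_dvd hd).resolve_right fun hd => hyx (hy.dvd_of_dvd_pow hd)
  refine Ideal.mem_span_pair.2 ⟨p' * x ^ m + q, s, mul_left_cancel₀ hy.ne_zero ?_⟩
  linear_combination h

theorem cube_mul_mem_of_add_mem (hy : Prime y) (hyx : ¬ y ∣ x) (k l : ℕ) {s t : R}
    (h : y ^ 3 * s + x ^ 3 * t ∈ Ideal.span {x ^ (k + 3), x * y, y ^ (l + 3)}) :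
    x ^ 3 * t ∈ Ideal.span {x ^ (k + 3), x * y, y ^ (l + 3)} := by
  obtain ⟨p, q, r, h⟩ := Submodule.mem_span_triple.1 h
  simp only [smul_eq_mul] at h
  have hd : y ∣ x ^ 3 * (t - p * x ^ k) :=
    ⟨q * x + r * y ^ (l + 2) - y ^ 2 * s, by linear_combination -h⟩
  obtain ⟨c, hc⟩ := (hy.dvd_or_dvd hd).resolve_left fun hd => hyx (hy.dvd_of_dvd_pow hd)
  refine Submodule.mem_span_triple.2 ⟨p, x ^ 2 * c, 0, ?_⟩
  simp only [smul_eq_mul]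
  linear_combination -x ^ 3 * hc

/-- Modulo `y` the ideal becomes `(x ^ (k + 3))`, so the coefficient of `x ^ 2` in one of its
elements lies in `(x, y)`. -/
theorem mem_span_pair_of_sq_mul_mem (hy : Prime y) (hyx : ¬ y ∣ x) (k : ℕ) {r s : R} {n : ℕ}
    (h : x ^ 2 * r + y * s ∈ Ideal.span {x ^ (k + 3), x * y, y ^ (n + 1)}) :
    r ∈ Ideal.span {x, y} := by
  obtain ⟨p, q, t, h⟩ := Submodule.mem_span_triple.1 h
  simp only [smul_eq_mul] at h
  have hd : y ∣ x ^ 2 * (r - p * x ^ (k + 1)) :=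
    ⟨q * x + t * y ^ n - s, by linear_combination -h⟩
  obtain ⟨c, hc⟩ := (hy.dvd_or_dvd hd).resolve_left fun hd => hyx (hy.dvd_of_dvd_pow hd)
  exact Ideal.mem_span_pair.2 ⟨p * x ^ k, c, by linear_combination -hc⟩

/-- The exponents in the ideal are those of the determinant of two vectors in `x F + y ^ 2 F`. -/
theorem mul_notMem_span_sq [IsDomain R] [IsLocalRing R] (hx : Prime x) (hxy : ¬ x ∣ y)
    (hm : maximalIdeal R = Ideal.span {x, y}) :
    x * y ∉ Ideal.span {x ^ 2, x * y ^ 2, y ^ 4} := by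
  intro h
  obtain ⟨p, q, t, h⟩ := Submodule.mem_span_triple.1 h
  simp only [smul_eq_mul] at h
  have hd : x ∣ t * y ^ 4 := ⟨y - p * x - q * y ^ 2, by linear_combination h⟩
  obtain ⟨c, rfl⟩ := (hx.dvd_or_dvd hd).resolve_right fun hd => hxy (hx.dvd_of_dvd_pow hd)
  have h1 : p * x + q * y ^ 2 + c * y ^ 4 = y :=
    mul_left_cancel₀ hx.ne_zero (by linear_combination h)
  have hd1 : x ∣ y * (1 - (q * y + c * y ^ 3)) := ⟨p, by linear_combination -h1⟩
  have hd2 := (hx.dvd_or_dvd hd1).resolve_left hxy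
  have hmem : 1 - (q * y + c * y ^ 3) ∈ maximalIdeal R := by
    rw [hm]; exact Ideal.mem_of_dvd _ hd2 (Ideal.subset_span (by simp))
  have hmem' : q * y + c * y ^ 3 ∈ maximalIdeal R := by
    rw [hm]; exact Ideal.mem_span_pair.2 ⟨0, q + c * y ^ 2, by ring⟩
  exact (maximalIdeal.isMaximal R).ne_top
    ((Ideal.eq_top_iff_one _).2 (by simpa using Ideal.add_mem _ hmem hmem'))

/-- Equivalently, `x y ∉ (x ^ 3, y ^ 3) + x y 𝔪`, and the right-hand side is `𝔪 ^ 3`. -/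
theorem mul_notMem_span_cube [IsDomain R] [IsLocalRing R] (hx : Prime x) (hxy : ¬ x ∣ y)
    (hm : maximalIdeal R = Ideal.span {x, y}) {r : R}
    (hr : r ∈ maximalIdeal R) : x * y * (1 + r) ∉ Ideal.span {x ^ 3, y ^ 3} := by
  intro h
  obtain ⟨p, q, h⟩ := Ideal.mem_span_pair.1 h
  have hd : x ∣ q * y ^ 3 := ⟨y * (1 + r) - p * x ^ 2, by linear_combination h⟩
  obtain ⟨c, rfl⟩ := (hx.dvd_or_dvd hd).resolve_right fun hd => hxy (hx.dvd_of_dvd_pow hd)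
  have h1 : p * x ^ 2 + c * y ^ 3 = y * (1 + r) :=
    mul_left_cancel₀ hx.ne_zero (by linear_combination h)
  have hd1 : x ∣ y * (1 + r - c * y ^ 2) := ⟨p * x, by linear_combination -h1⟩
  have hd2 := (hx.dvd_or_dvd hd1).resolve_left hxy
  have hmem : 1 + r - c * y ^ 2 ∈ maximalIdeal R := by
    rw [hm]; exact Ideal.mem_of_dvd _ hd2 (Ideal.subset_span (by simp))
  have hmem' : c * y ^ 2 - r ∈ maximalIdeal R := by
    refine Ideal.sub_mem _ ?_ hr
    rw [hm]; exact Ideal.mem_span_pair.2 ⟨0, c * y, by ring⟩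
  exact (maximalIdeal.isMaximal R).ne_top
    ((Ideal.eq_top_iff_one _).2 (by simpa using Ideal.add_mem _ hmem hmem'))

theorem span_triple_swap (x y : R) (m n : ℕ) : Ideal.span {x ^ m, x * y, y ^ n} =
    Ideal.span {y ^ n, y * x, x ^ m} := by
  rw [mul_comm y x]; congr 1; ext z; simp; tauto

end Ring

/-! ### Self-polar submodules of a free module of rank two -/

section Adapted
variable {R F : Type*} [CommRing R] [AddCommGroup F] [Module R F]
variable {b : Basis (Fin 2) R F} {N : Submodule R F} {I : Ideal R} {x y : R}

/-- A basis `e₁, e₂` of `F` in which membership in `N` is controlled coordinate by coordinate: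
the conditions amount to `v₂ ∈ I : x` and `v₁ ∈ I : y` for `v = v₁ e₁ + v₂ e₂` in `N`. -/
def IsAdapted (b : Basis (Fin 2) R F) (N : Submodule R F) (I : Ideal R) (x y : R) (e₁ e₂ : F) :
    Prop :=
  IsUnit (wedge b e₁ e₂) ∧ ∀ v ∈ N, x * wedge b e₁ v ∈ I ∧ y * wedge b v e₂ ∈ I

theorem IsAdapted.swap {e₁ e₂ : F} (h : IsAdapted b N I x y e₁ e₂) :
    IsAdapted b N I y x e₂ e₁ := by
  refine ⟨by rw [wedge_swap]; exact h.1.neg, fun v hv => ?_⟩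
  rw [wedge_swap b e₂ v, wedge_swap b v e₁, mul_neg, mul_neg]
  exact ⟨I.neg_mem (h.2 v hv).2, I.neg_mem (h.2 v hv).1⟩

end Adapted

section SelfPolar
variable {R F : Type*} [CommRing R] [IsLocalRing R] [AddCommGroup F] [Module R F]

/-- The submodule `N` of the free module `F` of rank two lies in `𝔪 F`, the ideal generated by the
determinants of pairs of elements of `N` is `I`, and `N` is its own polar for the determinant
pairing with values in `R ⧸ I`. -/
structure IsSelfPolar (b : Basis (Fin 2) R F) (N : Submodule R F) (I : Ideal R) : Prop where
  wedge_mem_maximalIdeal : ∀ v ∈ N, ∀ a, wedge b v a ∈ maximalIdeal R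
  wedge_mem : ∀ v ∈ N, ∀ w ∈ N, wedge b v w ∈ I
  mem_of_wedge_mem : ∀ v, (∀ a ∈ N, wedge b v a ∈ I) → v ∈ N
  le_of_wedge_mem : ∀ J : Ideal R, (∀ v ∈ N, ∀ w ∈ N, wedge b v w ∈ J) → I ≤ J

variable {b : Basis (Fin 2) R F} {N : Submodule R F} {I : Ideal R} {x y : R}

/-- The hypothesis on `v` says that `v ∈ 𝔪 F`. -/
theorem exists_eq_smul_add_smul (hm : maximalIdeal R = Ideal.span {x, y}) {v : F}
    (hv : ∀ a, wedge b v a ∈ maximalIdeal R) : ∃ a c : F, v = x • a + y • c := by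
  have h01 : wedge b (b 0) (b 1) = 1 := by simp [wedge_apply]
  have h := wedge_smul_eq b (b 0) (b 1) v
  have h1 := hv (b 1)
  have h0 := hv (b 0)
  rw [hm] at h0 h1
  obtain ⟨p, q, h0⟩ := Ideal.mem_span_pair.1 h0
  obtain ⟨r, s, h1⟩ := Ideal.mem_span_pair.1 h1
  rw [h01, one_smul, wedge_swap b (b 0) v, ← h0, ← h1] at h
  refine ⟨r • b 0 - p • b 1, s • b 0 - q • b 1, ?_⟩
  rw [h]
  module

theorem isUnit_of_notMem {r : R} (h : r ∉ maximalIdeal R) : IsUnit r := by simpa using h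

/-- If `x ^ 2 ∈ I`, then `x F ⊆ N`. Since `x y` is not in the ideal of determinants of pairs from
`x F + y ^ 2 F`, some element of `N` lies outside `x F + 𝔪 ^ 2 F`; modulo `x F` it is `y e₂` with
`e₂` a basis vector. -/
theorem IsSelfPolar.exists_isAdapted_of_sq_mem [IsDomain R] (hN : IsSelfPolar b N I)
    (hx : Prime x) (hxy : ¬ x ∣ y) (hm : maximalIdeal R = Ideal.span {x, y})
    (hx2 : x ^ 2 ∈ I) (hxyI : x * y ∈ I) : ∃ e₁ e₂, IsAdapted b N I x y e₁ e₂ := by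
  have hmul : ∀ r ∈ maximalIdeal R, x * r ∈ I := by
    intro r hr
    rw [hm] at hr
    obtain ⟨p, q, rfl⟩ := Ideal.mem_span_pair.1 hr
    have : x * (p * x + q * y) = p * x ^ 2 + q * (x * y) := by ring
    rw [this]
    exact I.add_mem (I.mul_mem_left _ hx2) (I.mul_mem_left _ hxyI)
  have hxF : ∀ a : F, x • a ∈ N := fun a => hN.mem_of_wedge_mem _ fun c hc => by
    rw [map_smul, LinearMap.smul_apply, smul_eq_mul, wedge_swap]
    exact hmul _ (neg_mem (hN.wedge_mem_maximalIdeal c hc a))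
  obtain ⟨a, d, f, hv, hu⟩ : ∃ a d f : F, x • a + y • d ∈ N ∧ IsUnit (wedge b d f) := by
    by_contra! hcon
    have hdec : ∀ v ∈ N, ∃ a c : F, v = x • a + y ^ 2 • c := by
      intro v hv
      obtain ⟨a, d, rfl⟩ := exists_eq_smul_add_smul hm (hN.wedge_mem_maximalIdeal v hv)
      obtain ⟨a', d', rfl⟩ := exists_eq_smul_add_smul (b := b) (v := d) hm fun f => by
        by_contra h
        exact hcon a d f hv (isUnit_of_notMem h)
      exact ⟨a + y • a', d', by module⟩
    refine mul_notMem_span_sq hx hxy hm (hN.le_of_wedge_mem _ ?_ hxyI)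
    intro v hv w hw
    obtain ⟨a, c, rfl⟩ := hdec v hv
    obtain ⟨a', c', rfl⟩ := hdec w hw
    refine Submodule.mem_span_triple.2
      ⟨wedge b a a', wedge b a c' + wedge b c a', wedge b c c', ?_⟩
    simp only [map_add, map_smul, LinearMap.add_apply, LinearMap.smul_apply, smul_eq_mul]
    ring
  have hyd : y • d ∈ N := by simpa using N.sub_mem hv (hxF a)
  refine ⟨f, d, by rw [wedge_swap]; exact hu.neg, fun v hv => ⟨?_, ?_⟩⟩
  · rw [wedge_swap]
    exact hmul _ (neg_mem (hN.wedge_mem_maximalIdeal v hv f))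
  · simpa using hN.wedge_mem v hv _ hyd

/-- For elements `x a + y c` and `x g + y d` of `N`, the determinant
`x ^ 2 (a ∧ g) + x y (a ∧ d + c ∧ g) + y ^ 2 (c ∧ d)` lies in an ideal contained in `(x y) + 𝔪 ^ 3`,
so `a ∧ g` and `c ∧ d` lie in `𝔪`. Since `x y ∉ 𝔪 ^ 3`, the middle coefficient is a unit for some
pair, and one of its two summands is then a unit. -/
theorem IsSelfPolar.exists_pair [IsDomain R] (hx : Prime x) (hy : Prime y) (hxy : ¬ x ∣ y)
    (hyx : ¬ y ∣ x) (hm : maximalIdeal R = Ideal.span {x, y}) (k l : ℕ)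
    (hN : IsSelfPolar b N (Ideal.span {x ^ (k + 3), x * y, y ^ (l + 3)})) :
    ∃ a c d g : F, x • a + y • c ∈ N ∧ x • g + y • d ∈ N ∧ IsUnit (wedge b a d) ∧
      wedge b a g ∈ maximalIdeal R ∧ wedge b c d ∈ maximalIdeal R ∧
      IsUnit (wedge b a d + wedge b c g) := by
  have hexp : ∀ a c g d : F, wedge b (x • a + y • c) (x • g + y • d) =
      x ^ 2 * wedge b a g + x * y * (wedge b a d + wedge b c g) + y ^ 2 * wedge b c d := by
    intro a c g d
    simp only [map_add, map_smul, LinearMap.add_apply, LinearMap.smul_apply, smul_eq_mul]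
    ring
  have hcoef : ∀ a c g d : F, x • a + y • c ∈ N → x • g + y • d ∈ N →
      wedge b a g ∈ maximalIdeal R ∧ wedge b c d ∈ maximalIdeal R := by
    intro a c g d hu hw
    have h := hN.wedge_mem _ hu _ hw
    rw [hexp] at h
    rw [hm]
    constructor
    · refine mem_span_pair_of_sq_mul_mem hy hyx k (n := l + 2)
        (s := x * (wedge b a d + wedge b c g) + y * wedge b c d) ?_
      convert h using 1
      ring
    · rw [Set.pair_comm]
      refine mem_span_pair_of_sq_mul_mem hx hxy l (n := k + 2)
        (s := y * (wedge b a d + wedge b c g) + x * wedge b a g) ?_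
      rw [← span_triple_swap]
      convert h using 1
      ring
  obtain ⟨a, c, g, d, hu, hw, hunit⟩ : ∃ a c g d : F, x • a + y • c ∈ N ∧ x • g + y • d ∈ N ∧
      IsUnit (wedge b a d + wedge b c g) := by
    by_contra! hcon
    have hle := hN.le_of_wedge_mem (Ideal.span {x ^ 3, y ^ 3} ⊔ Ideal.span {x * y} * maximalIdeal R)
      ?_ (Ideal.subset_span (by simp : x * y ∈ _))
    · obtain ⟨s, hs, t, ht, hst⟩ := Submodule.mem_sup.1 hle
      obtain ⟨r, hr, rfl⟩ := Ideal.mem_span_singleton_mul.1 ht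
      refine mul_notMem_span_cube hx hxy hm (neg_mem hr) ?_
      convert hs using 1
      linear_combination -hst
    · intro v hv w hw
      obtain ⟨a, c, rfl⟩ := exists_eq_smul_add_smul hm (hN.wedge_mem_maximalIdeal v hv)
      obtain ⟨g, d, rfl⟩ := exists_eq_smul_add_smul hm (hN.wedge_mem_maximalIdeal w hw)
      obtain ⟨h1, h2⟩ := hcoef _ _ _ _ hv hw
      have h3 : wedge b a d + wedge b c g ∈ maximalIdeal R := by
        by_contra h
        exact hcon a c g d hv hw (isUnit_of_notMem h)
      rw [hm] at h1 h2
      obtain ⟨p, q, h1⟩ := Ideal.mem_span_pair.1 h1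
      obtain ⟨p', q', h2⟩ := Ideal.mem_span_pair.1 h2
      have hxm : x ∈ maximalIdeal R := hm ▸ Ideal.subset_span (by simp)
      have hym : y ∈ maximalIdeal R := hm ▸ Ideal.subset_span (by simp)
      have : wedge b (x • a + y • c) (x • g + y • d) = (p * x ^ 3 + q' * y ^ 3) +
          x * y * (q * x + p' * y + (wedge b a d + wedge b c g)) := by
        rw [hexp, ← h1, ← h2]; ring
      rw [this]
      refine Submodule.add_mem_sup (Ideal.mem_span_pair.2 ⟨p, q', rfl⟩)
        (Ideal.mul_mem_mul (Ideal.mem_span_singleton_self _) ?_)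
      exact add_mem (add_mem (Ideal.mul_mem_left _ _ hxm) (Ideal.mul_mem_left _ _ hym)) h3
  obtain ⟨h1, h2⟩ := hcoef _ _ _ _ hu hw
  rcases IsLocalRing.isUnit_or_isUnit_of_isUnit_add hunit with h | h
  · exact ⟨a, c, d, g, hu, hw, h, h1, h2, hunit⟩
  · refine ⟨g, d, c, a, hw, hu, ?_, ?_, ?_, ?_⟩
    · rw [wedge_swap]; exact h.neg
    · rw [wedge_swap]; exact neg_mem h1
    · rw [wedge_swap]; exact neg_mem h2
    · rw [wedge_swap b g, wedge_swap b d, ← neg_add, add_comm]; exact hunit.neg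

/-- The pair of `IsSelfPolar.exists_pair` spans, modulo `𝔪 ^ 2 F`, the same space as `x e₁, y e₂`
for a suitable basis `e₁, e₂`, which can be chosen such that the lifts of `x e₁` and `y e₂` to `N`
have error terms in `y 𝔪 F` and `x 𝔪 F` respectively. -/
theorem exists_basis_smul_add_mem {a c d g : F} (hu : x • a + y • c ∈ N) (hw : x • g + y • d ∈ N)
    (had : IsUnit (wedge b a d)) (hag : wedge b a g ∈ maximalIdeal R)
    (hcd : wedge b c d ∈ maximalIdeal R) (hunit : IsUnit (wedge b a d + wedge b c g)) :
    ∃ (e₁ e₂ f₁ f₂ : F) (p q : R), IsUnit (wedge b e₁ e₂) ∧ p ∈ maximalIdeal R ∧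
      q ∈ maximalIdeal R ∧ x • e₁ + (y * p) • f₁ ∈ N ∧ y • e₂ + (x * q) • f₂ ∈ N := by
  obtain ⟨r, hr⟩ := had.exists_right_inv
  obtain ⟨b₁, hb₁⟩ : ∃ b₁, wedge b c d * r = b₁ := ⟨_, rfl⟩
  obtain ⟨c₂, hc₂⟩ : ∃ c₂, wedge b a g * r = c₂ := ⟨_, rfl⟩
  have hb₁m : b₁ ∈ maximalIdeal R := hb₁ ▸ Ideal.mul_mem_right _ _ hcd
  have hc₂m : c₂ ∈ maximalIdeal R := hc₂ ▸ Ideal.mul_mem_right _ _ hag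
  obtain ⟨b₂, hc⟩ : ∃ b₂ : R, c = b₁ • a + b₂ • d :=
    ⟨_, hb₁ ▸ eq_smul_add_smul_of_mul_eq_one hr c⟩
  obtain ⟨c₁, hg⟩ : ∃ c₁ : R, g = c₁ • a + c₂ • d :=
    ⟨_, hc₂ ▸ eq_smul_add_smul_of_mul_eq_one hr g⟩
  subst hc hg
  have hda : wedge b d a = -wedge b a d := wedge_swap _ _ _
  -- `u - b₂ w` and `w - c₁ u`, where the coefficients `b₁, c₂` in `c = b₁ a + b₂ d` and
  -- `g = c₁ a + c₂ d` lie in `𝔪`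
  refine ⟨(1 - b₂ * c₁) • a - (b₂ * c₂) • d, (1 - b₂ * c₁) • d - (c₁ * b₁) • a, a, d, b₁, c₂,
    ?_, hb₁m, hc₂m, ?_, ?_⟩
  · refine isUnit_of_notMem fun h => ?_
    simp only [map_add, map_sub, map_smul, LinearMap.add_apply, LinearMap.sub_apply,
      LinearMap.smul_apply, smul_eq_mul, wedge_self, hda] at h hunit
    have h1 : wedge b a d * (1 - b₂ * c₁) ^ 2 ∈ maximalIdeal R := by
      have := add_mem h (Ideal.mul_mem_left _ (wedge b a d * b₂ * c₂ * c₁) hb₁m)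
      convert this using 1
      ring
    have h2 : 1 - b₂ * c₁ ∈ maximalIdeal R :=
      (maximalIdeal.isMaximal R).isPrime.mem_of_pow_mem _
        ((Ideal.unit_mul_mem_iff_mem _ had).1 h1)
    refine (mem_maximalIdeal _).1 ?_ hunit
    have := add_mem (Ideal.mul_mem_left _ (wedge b a d) h2)
      (Ideal.mul_mem_left _ (wedge b a d * b₁) hc₂m)
    convert this using 1
    ring
  · convert N.sub_mem hu (N.smul_mem b₂ hw) using 1
    module
  · convert N.sub_mem hw (N.smul_mem c₁ hu) using 1
    module

theorem IsSelfPolar.mul_smul_mem (hN : IsSelfPolar b N I) {r : R} (hr : r ∈ I) (a : F) :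
    r • a ∈ N :=
  hN.mem_of_wedge_mem _ fun c _ => by
    rw [map_smul, LinearMap.smul_apply, smul_eq_mul]
    exact I.mul_mem_right _ hr

/-- Since `x y F ⊆ N`, the error terms of `exists_basis_smul_add_mem` may be taken in `y ^ 2 F` and
`x ^ 2 F`, and then each element clears the off-diagonal coordinate of the other. -/
theorem IsSelfPolar.exists_smul_mem (hm : maximalIdeal R = Ideal.span {x, y})
    (hN : IsSelfPolar b N I) (hxyI : x * y ∈ I) {e₁ e₂ f₁ f₂ : F} {p q : R}
    (he : IsUnit (wedge b e₁ e₂)) (hp : p ∈ maximalIdeal R) (hq : q ∈ maximalIdeal R)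
    (hu : x • e₁ + (y * p) • f₁ ∈ N) (hw : y • e₂ + (x * q) • f₂ ∈ N) :
    ∃ s t : R, (x + y ^ 2 * s) • e₁ ∈ N ∧ (y + x ^ 2 * t) • e₂ ∈ N := by
  obtain ⟨r, hr⟩ := he.exists_right_inv
  rw [hm] at hp hq
  obtain ⟨p₁, p₂, rfl⟩ := Ideal.mem_span_pair.1 hp
  obtain ⟨q₁, q₂, rfl⟩ := Ideal.mem_span_pair.1 hq
  obtain ⟨s, s', hf₁⟩ : ∃ s s' : R, f₁ = s • e₁ + s' • e₂ :=
    ⟨_, _, eq_smul_add_smul_of_mul_eq_one hr f₁⟩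
  obtain ⟨t', t, hf₂⟩ : ∃ t' t : R, f₂ = t' • e₁ + t • e₂ :=
    ⟨_, _, eq_smul_add_smul_of_mul_eq_one hr f₂⟩
  subst hf₁ hf₂
  have hxyN := hN.mul_smul_mem hxyI
  refine ⟨p₂ * s, q₁ * t, ?_, ?_⟩
  · -- subtract a multiple of the second element; what remains off `e₁` is a multiple of `x y`
    convert N.add_mem (N.sub_mem hu (N.smul_mem (y * p₂ * s') hw))
      (hxyN (-(p₁ • (s • e₁ + s' • e₂)) +
        (p₂ * s' * (x * q₁ + y * q₂)) • (t' • e₁ + t • e₂))) using 1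
    module
  · convert N.add_mem (N.sub_mem hw (N.smul_mem (x * q₁ * t') hu))
      (hxyN (-(q₂ • (t' • e₁ + t • e₂)) +
        (q₁ * t' * (x * p₁ + y * p₂)) • (s • e₁ + s' • e₂))) using 1
    module

theorem IsSelfPolar.mul_wedge_mem (hm : maximalIdeal R = Ideal.span {x, y})
    (hN : IsSelfPolar b N I) (hxyI : x * y ∈ I) {s : R} (hs : y ^ 3 * s ∈ I) {e v : F}
    (he : (x + y ^ 2 * s) • e ∈ N) (hv : v ∈ N) : x * wedge b e v ∈ I := by
  have h := hN.wedge_mem _ he v hv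
  have hmem := neg_mem (hN.wedge_mem_maximalIdeal v hv e)
  rw [← wedge_swap, hm] at hmem
  obtain ⟨p, q, hpq⟩ := Ideal.mem_span_pair.1 hmem
  rw [map_smul, LinearMap.smul_apply, smul_eq_mul] at h
  have h' := I.sub_mem h (I.add_mem (I.mul_mem_left (y * s * p) hxyI) (I.mul_mem_left q hs))
  convert h' using 1
  rw [← hpq]; ring

/-- When `m, n ≥ 3`, the determinant of the elements `(x + y ^ 2 s) e₁` and `(y + x ^ 2 t) e₂` of
`N` forces `y ^ 3 s + x ^ 3 t`, hence each summand, into the ideal; the perturbations `y ^ 2 s` and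
`x ^ 2 t` are then harmless because `N ⊆ 𝔪 F`. -/
theorem IsSelfPolar.exists_isAdapted [IsDomain R] (hx : Prime x) (hy : Prime y) (hxy : ¬ x ∣ y)
    (hyx : ¬ y ∣ x) (hm : maximalIdeal R = Ideal.span {x, y}) {m n : ℕ} (hm2 : 2 ≤ m) (hn2 : 2 ≤ n)
    (hN : IsSelfPolar b N (Ideal.span {x ^ m, x * y, y ^ n})) :
    ∃ e₁ e₂, IsAdapted b N (Ideal.span {x ^ m, x * y, y ^ n}) x y e₁ e₂ := by
  have hxyI : x * y ∈ Ideal.span {x ^ m, x * y, y ^ n} := Ideal.subset_span (by simp)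
  obtain rfl | hm3 := hm2.eq_or_lt
  · exact hN.exists_isAdapted_of_sq_mem hx hxy hm (Ideal.subset_span (by simp)) hxyI
  obtain rfl | hn3 := hn2.eq_or_lt
  · obtain ⟨e₁, e₂, h⟩ := hN.exists_isAdapted_of_sq_mem hy hyx (by rw [hm, Set.pair_comm])
      (Ideal.subset_span (by simp)) (mul_comm x y ▸ hxyI)
    exact ⟨e₂, e₁, h.swap⟩
  obtain ⟨k, rfl⟩ := Nat.exists_eq_add_of_le' hm3
  obtain ⟨l, rfl⟩ := Nat.exists_eq_add_of_le' hn3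
  obtain ⟨a, c, d, g, hu, hw, had, hag, hcd, hunit⟩ := hN.exists_pair hx hy hxy hyx hm
  obtain ⟨e₁, e₂, f₁, f₂, p, q, he, hp, hq, hu', hw'⟩ :=
    exists_basis_smul_add_mem hu hw had hag hcd hunit
  obtain ⟨s, t, h1, h2⟩ := hN.exists_smul_mem hm hxyI he hp hq hu' hw'
  have h3 : y ^ 3 * s + x ^ 3 * t ∈ Ideal.span {x ^ (k + 3), x * y, y ^ (l + 3)} := by
    have h := hN.wedge_mem _ h1 _ h2
    simp only [map_smul, LinearMap.smul_apply, smul_eq_mul] at h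
    rw [← mul_assoc, Ideal.mul_unit_mem_iff_mem _ he] at h
    convert Ideal.sub_mem _ h (Ideal.mul_mem_left _ (1 + x * y * s * t) hxyI) using 1
    ring
  have ht := cube_mul_mem_of_add_mem hy hyx k l h3
  have hs := by simpa using Ideal.sub_mem _ h3 ht
  refine ⟨e₁, e₂, he, fun v hv => ⟨hN.mul_wedge_mem hm hxyI hs h1 hv, ?_⟩⟩
  rw [wedge_swap, mul_neg]
  exact neg_mem (hN.mul_wedge_mem (by rw [hm, Set.pair_comm]) (mul_comm x y ▸ hxyI) ht h2 hv)

/-- In an adapted basis `N` is a direct sum of two ideals: it is contained in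
`(x, y ^ (n - 1)) e₁ + (x ^ (m - 1), y) e₂`, whose determinants against itself lie in the ideal, so
equality follows by self-polarity. -/
theorem IsSelfPolar.mem_iff [IsDomain R] (hx : Prime x) (hy : Prime y) (hxy : ¬ x ∣ y)
    (hyx : ¬ y ∣ x) {m n : ℕ} (hm2 : 2 ≤ m) (hn2 : 2 ≤ n) {e₁ e₂ : F}
    (hN : IsSelfPolar b N (Ideal.span {x ^ m, x * y, y ^ n}))
    (he : IsAdapted b N (Ideal.span {x ^ m, x * y, y ^ n}) x y e₁ e₂) (v : F) :
    v ∈ N ↔ wedge b v e₂ ∈ Ideal.span {x, y ^ (n - 1)} ∧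
      wedge b e₁ v ∈ Ideal.span {x ^ (m - 1), y} := by
  obtain ⟨m, rfl⟩ := Nat.exists_eq_add_of_le' hm2
  obtain ⟨n, rfl⟩ := Nat.exists_eq_add_of_le' hn2
  have hmem : ∀ v ∈ N, wedge b v e₂ ∈ Ideal.span {x, y ^ (n + 1)} ∧
      wedge b e₁ v ∈ Ideal.span {x ^ (m + 1), y} := by
    intro v hv
    obtain ⟨h1, h2⟩ := he.2 v hv
    refine ⟨mem_span_of_mul_mem hy hyx (m + 1) (n + 1) h2, ?_⟩
    rw [Set.pair_comm]
    rw [span_triple_swap] at h1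
    exact mem_span_of_mul_mem hx hxy (n + 1) (m + 1) h1
  refine ⟨hmem v, fun ⟨h1, h2⟩ => hN.mem_of_wedge_mem _ fun a ha => ?_⟩
  obtain ⟨h3, h4⟩ := hmem a ha
  have hle : ∀ p ∈ Ideal.span {x, y ^ (n + 1)}, ∀ q ∈ Ideal.span {x ^ (m + 1), y},
      p * q ∈ Ideal.span {x ^ (m + 2), x * y, y ^ (n + 2)} := by
    intro p hp q hq
    obtain ⟨p₁, p₂, rfl⟩ := Ideal.mem_span_pair.1 hp
    obtain ⟨q₁, q₂, rfl⟩ := Ideal.mem_span_pair.1 hq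
    refine Submodule.mem_span_triple.2
      ⟨p₁ * q₁, p₁ * q₂ + p₂ * q₁ * x ^ m * y ^ n, p₂ * q₂, ?_⟩
    simp only [smul_eq_mul]
    ring
  rw [← Ideal.unit_mul_mem_iff_mem _ he.1, wedge_mul_wedge, wedge_swap b e₂ a, mul_neg,
    mul_comm (wedge b e₁ v)]
  exact add_mem (hle _ h1 _ h4) (neg_mem (hle _ h3 _ h2))

end SelfPolar

/-! ### Integrally closed modules as self-polar submodules -/

section Bidual
variable {R M : Type*} [CommRing R] [AddCommGroup M] [Module R M]

/-- By its definition through bases of `M**`, the ideal `I(M)` can only be nonzero if `M**` is free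
of the rank of `M`; one basis then suffices to compute it. -/
theorem exists_basis_minorIdeal_eq (hrank : finrank R M = 2) (hI : minorIdeal R M ≠ ⊥) :
    ∃ b : Basis (Fin 2) R (Bidual R M), minorIdeal R M =
      Ideal.span {d | ∃ a c : M, d = wedge b (toBidual R M a) (toBidual R M c)} := by
  obtain ⟨b⟩ : Nonempty (Basis (Fin (finrank R M)) R (Bidual R M)) := by
    by_contra h
    refine hI (Ideal.span_eq_bot.2 ?_)
    rintro _ ⟨b, -⟩
    exact absurd ⟨b⟩ h
  refine ⟨b.reindex (finCongr hrank), ?_⟩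
  rw [minorIdeal_eq b (id : M → M) (by simp)]
  have hdet : ∀ s : Fin (finrank R M) → M, (b.toMatrix fun j => toBidual R M (s j)).det =
      wedge (b.reindex (finCongr hrank)) (toBidual R M (s ((finCongr hrank).symm 0)))
        (toBidual R M (s ((finCongr hrank).symm 1))) := by
    intro s
    rw [← Matrix.det_submatrix_equiv_self (finCongr hrank).symm,
      ← det_toMatrix_eq_wedge _ (fun j => toBidual R M (s ((finCongr hrank).symm j)))]
    congr 1
  congr 1
  ext d
  constructor
  · rintro ⟨s, rfl⟩
    exact ⟨_, _, hdet s⟩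
  · rintro ⟨a, c, rfl⟩
    refine ⟨fun j => ![a, c] (finCongr hrank j), ?_⟩
    simp only [id]
    rw [hdet]
    simp

theorem isSelfPolar_range [IsDomain R] [IsLocalRing R] [IsNoetherianRing R] [IsTorsionFree R M]
    (hclosed : IsIntegrallyClosedModule R M) (hfree : HasNoFreeSummand R M)
    (hI : minorIdeal R M ≠ ⊥) (b : Basis (Fin 2) R (Bidual R M))
    (hb : minorIdeal R M =
      Ideal.span {d | ∃ a c : M, d = wedge b (toBidual R M a) (toBidual R M c)}) :
    IsSelfPolar b (LinearMap.range (toBidual R M)) (minorIdeal R M) where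
  wedge_mem_maximalIdeal := by
    rintro _ ⟨a, rfl⟩ v
    exact sub_mem (Ideal.mul_mem_right _ _ (repr_toBidual_mem_maximalIdeal hfree b a 0))
      (Ideal.mul_mem_right _ _ (repr_toBidual_mem_maximalIdeal hfree b a 1))
  wedge_mem := by
    rintro _ ⟨a, rfl⟩ _ ⟨c, rfl⟩
    rw [hb]
    exact Ideal.subset_span ⟨a, c, rfl⟩
  mem_of_wedge_mem v hv := hclosed v <|
    isIntegralOver_of_wedge_mem b _ hb (IsNoetherian.noetherian _) hI v fun a => hv _ ⟨a, rfl⟩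
  le_of_wedge_mem J hJ := by
    rw [hb, Ideal.span_le]
    rintro _ ⟨a, c, rfl⟩
    exact hJ _ ⟨a, rfl⟩ _ ⟨c, rfl⟩

/-- If the image of `M` in `F` is `{v₁ e₁ + v₂ e₂ | v₁ ∈ J₁, v₂ ∈ J₂}` for a basis `e₁, e₂`, then
`M` is isomorphic to `J₁ ⊕ J₂`. -/
theorem nonempty_linearEquiv_prod {F : Type*} [AddCommGroup F] [Module R F] (f : M →ₗ[R] F)
    (hf : Function.Injective f) (b : Basis (Fin 2) R F) {e₁ e₂ : F} (he : IsUnit (wedge b e₁ e₂))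
    (J₁ J₂ : Ideal R)
    (h : ∀ v, v ∈ LinearMap.range f ↔ wedge b v e₂ ∈ J₁ ∧ wedge b e₁ v ∈ J₂) :
    Nonempty (M ≃ₗ[R] J₁ × J₂) := by
  let g : M →ₗ[R] J₁ × J₂ := LinearMap.prod
    (((wedge b).flip e₂ ∘ₗ f).codRestrict J₁ fun a => ((h _).1 ⟨a, rfl⟩).1)
    ((wedge b e₁ ∘ₗ f).codRestrict J₂ fun a => ((h _).1 ⟨a, rfl⟩).2)
  obtain ⟨r, hr⟩ := he.exists_right_inv
  refine ⟨LinearEquiv.ofBijective g ⟨?_, ?_⟩⟩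
  · rw [← LinearMap.ker_eq_bot, LinearMap.ker_eq_bot']
    intro a ha
    have h1 : wedge b (f a) e₂ = 0 := congrArg (fun z => (z.1 : R)) ha
    have h2 : wedge b e₁ (f a) = 0 := congrArg (fun z => (z.2 : R)) ha
    apply hf
    rw [eq_smul_add_smul_of_mul_eq_one hr (f a), h1, h2]
    simp
  · rintro ⟨⟨p, hp⟩, ⟨q, hq⟩⟩
    have h1 : wedge b ((p * r) • e₁ + (q * r) • e₂) e₂ = p := by
      simp only [map_add, map_smul, LinearMap.add_apply, LinearMap.smul_apply, smul_eq_mul,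
        wedge_self]
      linear_combination p * hr
    have h2 : wedge b e₁ ((p * r) • e₁ + (q * r) • e₂) = q := by
      simp only [map_add, map_smul, smul_eq_mul, wedge_self]
      linear_combination q * hr
    obtain ⟨a, ha⟩ := (h ((p * r) • e₁ + (q * r) • e₂)).2 ⟨by rwa [h1], by rwa [h2]⟩
    refine ⟨a, Prod.ext (Subtype.ext ?_) (Subtype.ext ?_)⟩
    · exact (congrArg (fun z => wedge b z e₂) ha).trans h1
    · exact (congrArg (wedge b e₁) ha).trans h2

end Bidual

end RankTwo

open RankTwo

theorem mainTheorem4 {R : Type*} [CommRing R] [IsRegularLocalRing R]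
    (hdim : ringKrullDim R = 2) [Infinite (IsLocalRing.ResidueField R)]
    (x y : R) (hxy : IsLocalRing.maximalIdeal R = Ideal.span {x, y})
    (m n : ℕ) (hm : 2 ≤ m) (hn : 2 ≤ n)
    (M : Type*) [AddCommGroup M] [Module R M] [Module.Finite R M] [Module.IsTorsionFree R M]
    (hrank : Module.finrank R M = 2)
    (hclosed : RankTwo.IsIntegrallyClosedModule R M)
    (hfree : RankTwo.HasNoFreeSummand R M)
    (hI : RankTwo.minorIdeal R M = Ideal.span {x ^ m, x * y, y ^ n}) :
    Nonempty (M ≃ₗ[R]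
      ((Ideal.span {x, y ^ (n - 1)} : Ideal R) × (Ideal.span {x ^ (m - 1), y} : Ideal R))) ∧
    RankTwo.IsDecomposable R M := by
  have hyx : IsLocalRing.maximalIdeal R = Ideal.span {y, x} := by rw [hxy, Set.pair_comm]
  have hdom : IsDomain R := isDomain_of_ringKrullDim hdim hxy
  have hdvd : ¬ x ∣ y := by
    simpa [Ideal.mem_span_singleton] using notMem_span_pow_of_ringKrullDim hdim hxy 1
  have hdvd' : ¬ y ∣ x := by
    simpa [Ideal.mem_span_singleton] using notMem_span_pow_of_ringKrullDim hdim hyx 1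
  have hx0 : x ≠ 0 := by rintro rfl; exact hdvd' (dvd_zero y)
  have hy0 : y ≠ 0 := by rintro rfl; exact hdvd (dvd_zero x)
  have hx : Prime x :=
    (Ideal.span_singleton_prime hx0).1 (span_singleton_isPrime_of_ringKrullDim hdim hxy)
  have hy : Prime y :=
    (Ideal.span_singleton_prime hy0).1 (span_singleton_isPrime_of_ringKrullDim hdim hyx)
  have hI0 : minorIdeal R M ≠ ⊥ := by
    rw [hI]
    exact fun h => mul_ne_zero hx0 hy0 (Ideal.span_eq_bot.1 h _ (by simp))
  obtain ⟨b, hb⟩ := exists_basis_minorIdeal_eq hrank hI0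
  have hN := isSelfPolar_range hclosed hfree hI0 b hb
  rw [hI] at hN
  obtain ⟨e₁, e₂, he⟩ := hN.exists_isAdapted hx hy hdvd hdvd' hxy hm hn
  obtain ⟨e⟩ := nonempty_linearEquiv_prod (toBidual R M) toBidual_injective b he.1 _ _
    (hN.mem_iff hx hy hdvd hdvd' hm hn he)
  have h1 : Nontrivial (Ideal.span {x, y ^ (n - 1)} : Ideal R) :=
    ⟨⟨x, Ideal.subset_span (by simp)⟩, 0, fun h => hx0 (congrArg Subtype.val h)⟩
  have h2 : Nontrivial (Ideal.span {x ^ (m - 1), y} : Ideal R) :=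
    ⟨⟨y, Ideal.subset_span (by simp)⟩, 0, fun h => hy0 (congrArg Subtype.val h)⟩
  exact ⟨⟨e⟩, isDecomposable_of_prod e⟩
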